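/- All graphs are finite, simple and undirected. A graph is \emph{edge-transitive} if for any two edges $e,f$ some automorphism maps $e$ to $f$; a \emph{star} is a graph isomorphic to $K_{1,n}$ for some $n\ge 0$. A path (a sequence of pairwise distinct vertices, consecutive ones adjacent; its length is its number of edges) \emph{closes to a cycle} in $G$ if it is a subgraph of some cycle of $G$. For a positive integer $n$, let $K_n^{\diamond}$ be the graph with vertices $v_i$ $(1\le i\le n)$ and $v_{ij}$ $(1\le i,j\le n,\ i\ne j)$, in which each $v_{ij}$ is adjacent to exactly $v_i$ and $v_j$, and there are no other edges (so every edge of $K_n$ is replaced by a $4$-cycle). \textbf{Theorem.} Let $G$ be a connected edge-transitive graph that is not a star. Then every path in $G$ of length at most $3$ closes to a cycle. Moreover, for every integer $\ell\ge 4$ there exist infinitely many pairwise non-isomorphic connected edge-transitive graphs each containing a path of length $\ell$ that does not close to a cycle: for every $\ell\ge 4$, the graph $K_n^{\diamond}$ is such a graph for all sufficiently large $n$, and $K_m^{\diamond}\not\cong K_n^{\diamond}$ whenever $m\ne n$. -/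

import Mathlib

/-- A graph is edge-transitive if any edge can be mapped to any other edge by an automorphism. -/
def IsEdgeTransitive {V : Type*} (G : SimpleGraph V) : Prop :=
  ∀ e ∈ G.edgeSet, ∀ f ∈ G.edgeSet, ∃ φ : G ≃g G, Sym2.map φ e = f

/-- A graph is a star if it is isomorphic to `K_{1,n}` for some `n ≥ 0`. -/
def IsStarGraph {V : Type*} (G : SimpleGraph V) : Prop :=
  ∃ n : ℕ, Nonempty (G ≃g completeBipartiteGraph (Fin 1) (Fin n))

/-- A walk closes to a cycle if it is a subgraph of some cycle of the graph. -/
def ClosesToCycle {V : Type*} {G : SimpleGraph V} {u v : V} (p : G.Walk u v) : Prop :=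
  ∃ (w : V) (c : G.Walk w w), c.IsCycle ∧ p.toSubgraph ≤ c.toSubgraph

/-- The vertices of `K_n^◇`: the vertices `v_i` of `K_n`, and a vertex `v_{ij}` for every
ordered pair of distinct indices `i`, `j`. -/
abbrev DiamondVertex (n : ℕ) : Type :=
  Fin n ⊕ {q : Fin n × Fin n // q.1 ≠ q.2}

/-- The graph `K_n^◇`, obtained from `K_n` by replacing every edge `v_i v_j` with the 4-cycle
`v_i, v_{ij}, v_j, v_{ji}`: the neighbours of `v_{ij}` are `v_i` and `v_j`, and there are no
other edges. -/
def diamondGraph (n : ℕ) : SimpleGraph (DiamondVertex n) where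
  Adj
    | .inl a, .inr q => a = q.1.1 ∨ a = q.1.2
    | .inr q, .inl a => a = q.1.1 ∨ a = q.1.2
    | .inl _, .inl _ => False
    | .inr _, .inr _ => False
  symm := ⟨by rintro (a | q) (b | r) h <;> exact h⟩
  loopless := ⟨by rintro (a | q) h <;> exact h⟩

/-! A path of length 2 or 3 closes to a cycle once deleting its interior leaves its ends connected,
so it suffices that no vertex and no adjacent pair separates `G` (`not_isFragment_singleton`,
`not_isFragment_pair`); shorter paths extend to length 2. Both follow by taking a smallest fragment
`C`: edge-transitivity yields a separator of the same kind meeting `C`, and one of its fragments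
either cuts `C` down to a smaller fragment (`IsFragment.inter`) or hangs on the part of that
separator outside `C` (`IsFragment.diff`), which is too small to separate.

In `K_n^◇`, a cycle through the degree-2 vertex `v_{01}` uses its edge to `v_0`. A path through
`v_{01}` that already has two other edges at `v_0` therefore cannot close. -/

open SimpleGraph

/-- `C` is a nonempty set of vertices outside `S` that is closed under adjacency in `G - S`
without being all of `G - S`. -/
structure IsFragment {V : Type*} (G : SimpleGraph V) (S C : Set V) : Prop where
  nonempty : C.Nonempty
  notMem : ∀ x ∈ C, x ∉ S
  compl_nonempty : ∃ d, d ∉ C ∧ d ∉ S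
  closed : ∀ x ∈ C, ∀ y, G.Adj x y → y ∈ C ∨ y ∈ S

namespace IsFragment

variable {V : Type*} {G : SimpleGraph V} {S C : Set V}

theorem compl (h : IsFragment G S C) : IsFragment G S {x | x ∉ C ∧ x ∉ S} where
  nonempty := h.compl_nonempty
  notMem _ hx := hx.2
  compl_nonempty := by
    obtain ⟨x, hx⟩ := h.nonempty
    exact ⟨x, fun hx' => hx'.1 hx, h.notMem x hx⟩
  closed x hx y hxy := by
    by_cases hy : y ∈ S
    · exact Or.inr hy
    · exact Or.inl ⟨fun hyC => (h.closed y hyC x hxy.symm).elim hx.1 hx.2, hy⟩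

/-- Any vertex outside `S` is avoided by some fragment. -/
theorem exists_notMem (h : IsFragment G S C) (v : V) : ∃ C', IsFragment G S C' ∧ v ∉ C' := by
  by_cases hv : v ∈ C
  · exact ⟨_, h.compl, fun hv' => hv'.1 hv⟩
  · exact ⟨C, h, hv⟩

theorem image (h : IsFragment G S C) (φ : G ≃g G) : IsFragment G (φ '' S) (φ '' C) where
  nonempty := h.nonempty.image φ
  notMem := by
    rintro _ ⟨x, hx, rfl⟩ ⟨y, hy, hxy⟩
    exact h.notMem x hx (φ.injective hxy ▸ hy)
  compl_nonempty := by
    obtain ⟨d, hd, hd'⟩ := h.compl_nonempty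
    refine ⟨φ d, ?_, ?_⟩
    · rintro ⟨y, hy, hxy⟩
      exact hd (φ.injective hxy ▸ hy)
    · rintro ⟨y, hy, hxy⟩
      exact hd' (φ.injective hxy ▸ hy)
  closed := by
    rintro _ ⟨x, hx, rfl⟩ y hxy
    obtain ⟨z, rfl⟩ := φ.surjective y
    exact (h.closed x hx z (φ.map_adj_iff.1 hxy)).imp (Set.mem_image_of_mem φ)
      (Set.mem_image_of_mem φ)

end IsFragment

/-! ### Separating vertices and separating edges. -/

section Connectivity

variable {V : Type*} {G : SimpleGraph V}

/-- A walk from `a` to `b` avoids `S` unless a fragment separates them. -/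
theorem exists_walk_avoiding {S : Set V} (hS : ∀ C, ¬ IsFragment G S C) {a b : V}
    (ha : a ∉ S) (hb : b ∉ S) : ∃ q : G.Walk a b, ∀ x ∈ q.support, x ∉ S := by
  by_contra hq
  refine hS {x | ∃ q : G.Walk a x, ∀ y ∈ q.support, y ∉ S} ⟨⟨a, Walk.nil, by simpa using ha⟩,
    fun x ⟨q, h⟩ => h x q.end_mem_support, ⟨b, hq, hb⟩, fun x ⟨q, h⟩ y hxy => ?_⟩
  by_cases hy : y ∈ S
  · exact Or.inr hy
  · refine Or.inl ⟨q.concat hxy, fun z hz => ?_⟩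
    rw [Walk.support_concat, List.mem_append, List.mem_singleton] at hz
    rcases hz with hz | rfl
    · exact h z hz
    · exact hy

theorem SimpleGraph.Connected.not_isFragment_empty (hG : G.Connected) (C : Set V) :
    ¬ IsFragment G ∅ C := by
  rintro ⟨⟨x, hx⟩, -, ⟨d, hd, -⟩, hC⟩
  obtain ⟨p⟩ := hG.preconnected x d
  have key : ∀ {u v : V} (p : G.Walk u v), u ∈ C → v ∈ C := by
    intro u v p
    induction p with
    | nil => exact id
    | cons h p ih => exact fun hu => ih ((hC _ hu _ h).resolve_right (Set.notMem_empty _))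
  exact hd (key p hx)

theorem IsEdgeTransitive.exists_iso (hG : IsEdgeTransitive G) {a b c d : V} (hab : G.Adj a b)
    (hcd : G.Adj c d) : ∃ φ : G ≃g G, (φ a = c ∧ φ b = d) ∨ (φ a = d ∧ φ b = c) := by
  obtain ⟨φ, hφ⟩ := hG s(a, b) hab s(c, d) hcd
  exact ⟨φ, by simpa using hφ⟩

theorem isStarGraph_of_adj_iff [Finite V] (c : V)
    (h : ∀ x y, G.Adj x y ↔ x ≠ y ∧ (x = c ∨ y = c)) : IsStarGraph G := by
  classical
  obtain ⟨n, ⟨e⟩⟩ := Finite.exists_equiv_fin {v : V // v ≠ c}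
  let f : Fin 1 ⊕ Fin n → V := Sum.elim (fun _ => c) (fun i => (e.symm i : V))
  have hf : Function.Bijective f := by
    constructor
    · rintro (i | i) (j | j) hij
      · rw [Subsingleton.elim i j]
      · exact absurd hij.symm (e.symm j).2
      · exact absurd hij (e.symm i).2
      · exact congrArg Sum.inr (e.symm.injective (Subtype.ext hij))
    · intro v
      by_cases hv : v = c
      · exact ⟨Sum.inl 0, hv.symm⟩
      · exact ⟨Sum.inr (e ⟨v, hv⟩), by simp [f]⟩
  refine ⟨n, ⟨RelIso.symm ⟨Equiv.ofBijective f hf, ?_⟩⟩⟩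
  rintro (i | i) (j | j)
  · simp [f]
  · simpa [f, h] using (e.symm j).2.symm
  · simpa [f, h] using (e.symm i).2
  · have hi := (e.symm i).2
    have hj := (e.symm j).2
    simp [f, h, hi, hj]

/-- In a connected edge-transitive graph that is not a star, there are no vertices of degree
at most one. -/
theorem exists_adj_ne [Finite V] (hG : G.Connected) (hE : IsEdgeTransitive G)
    (hS : ¬ IsStarGraph G) (x c : V) : ∃ y, y ≠ c ∧ G.Adj x y := by
  by_contra! hx
  by_cases hxc : G.Adj x c
  · -- every edge has an end of degree one
    have hleaf : ∀ z, G.Adj c z → ∀ y, G.Adj z y → y = c := by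
      intro z hz
      obtain ⟨φ, ⟨h1, h2⟩ | ⟨h1, h2⟩⟩ := hE.exists_iso hxc hz
      -- Here the leaf `x` goes to `c`, so both ends of the edge `xc` are leaves and `z = x`.
      · have hc : ∀ y, G.Adj c y → y = z := by
          intro y hy
          obtain ⟨y, rfl⟩ := φ.surjective y
          rw [← h1, φ.map_adj_iff] at hy
          by_contra hne
          exact hx y (fun hyc => hne (by rw [hyc, h2])) hy
        obtain rfl := hc x hxc.symm
        exact fun y hy => by_contra fun hne => hx y hne hy
      · intro y hy
        obtain ⟨y, rfl⟩ := φ.surjective y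
        rw [← h1, φ.map_adj_iff] at hy
        by_contra hne
        exact hx y (fun hyc => hne (by rw [hyc, h2])) hy
    have hall : ∀ y, y = c ∨ G.Adj c y := by
      by_contra! hy
      obtain ⟨y, hy⟩ := hy
      refine hG.not_isFragment_empty {y | y = c ∨ G.Adj c y} ⟨⟨c, Or.inl rfl⟩, by simp,
        ⟨y, by simpa using hy, by simp⟩, ?_⟩
      rintro z (rfl | hz) w hw
      · exact Or.inl (Or.inr hw)
      · exact Or.inl (Or.inl (hleaf z hz w hw))
    refine hS (isStarGraph_of_adj_iff c fun y z => ⟨fun h => ⟨h.ne, ?_⟩, ?_⟩)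
    · exact (hall y).imp_right fun hy => hleaf y hy z h
    · rintro ⟨hne, rfl | rfl⟩
      · exact (hall z).resolve_left hne.symm
      · exact ((hall y).resolve_left hne).symm
  -- Now `x` is isolated, so `G` is the one-vertex star `K_{1,0}`.
  · have hx' : ∀ y, ¬ G.Adj x y := fun y hy => hx y (fun h => hxc (h ▸ hy)) hy
    have hall : ∀ y, y = x := by
      by_contra! hy
      obtain ⟨y, hy⟩ := hy
      exact hG.not_isFragment_empty {x} ⟨⟨x, rfl⟩, by simp, ⟨y, hy, by simp⟩,
        fun z hz w hw => (hx' w (hz ▸ hw)).elim⟩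
    refine hS (isStarGraph_of_adj_iff x fun y z => ?_)
    rw [hall y, hall z]
    simp

/-- If `C` is a fragment of `G - S` and `D` is a fragment of `G - T` missing `S`, then `D ∩ C`
is again a fragment of `G - T` unless it is empty. -/
theorem IsFragment.inter {S T C D : Set V} (hC : IsFragment G S C) (hD : IsFragment G T D)
    (hST : ∀ x ∈ S, x ∉ D) (hne : (D ∩ C).Nonempty) : IsFragment G T (D ∩ C) where
  nonempty := hne
  notMem x hx := hD.notMem x hx.1
  compl_nonempty := by
    obtain ⟨d, hd, hd'⟩ := hD.compl_nonempty
    exact ⟨d, fun h => hd h.1, hd'⟩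
  closed x hx y hxy := by
    rcases hD.closed x hx.1 y hxy with hy | hy
    · exact Or.inl ⟨hy, (hC.closed x hx.2 y hxy).resolve_right fun h => hST y h hy⟩
    · exact Or.inr hy

/-- If fragments `C` of `G - S` and `D` of `G - T` are disjoint and `D` misses `S`, then `D` is
only attached to the part of `T` outside `C`. -/
theorem IsFragment.diff {S T C D : Set V} (hC : IsFragment G S C) (hD : IsFragment G T D)
    (hCD : ∀ x ∈ D, x ∉ C) (hST : ∀ x ∈ S, x ∉ D) : IsFragment G (T \ C) D where
  nonempty := hD.nonempty
  notMem x hx h := hD.notMem x hx h.1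
  compl_nonempty := by
    obtain ⟨d, hd, hd'⟩ := hD.compl_nonempty
    exact ⟨d, hd, fun h => hd' h.1⟩
  closed x hx y hxy := by
    by_cases hyC : y ∈ C
    · rcases hC.closed y hyC x hxy.symm with h | h
      · exact (hCD x hx h).elim
      · exact (hST x h hx).elim
    · exact (hD.closed x hx y hxy).imp_right fun h => ⟨h, hyC⟩

theorem not_isFragment_singleton [Finite V] (hG : G.Connected) (hE : IsEdgeTransitive G)
    (hS : ¬ IsStarGraph G) (c : V) (C : Set V) : ¬ IsFragment G {c} C := by
  induction hn : C.ncard using Nat.strong_induction_on generalizing c C with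
  | _ n ih =>
  subst hn
  intro hC
  -- By minimality of `C`, no vertex of `C` is a cutvertex. But an edge at `c` can be mapped to an
  -- edge inside `C`, which puts the image of `c` in `C`.
  have hcut : ∀ d ∈ C, ∀ D, ¬ IsFragment G {d} D := by
    intro d hd D₀ hD₀
    obtain ⟨D, hD, hcD⟩ := hD₀.exists_notMem c
    have hST : ∀ x ∈ ({c} : Set V), x ∉ D := by simpa using hcD
    by_cases hne : (D ∩ C).Nonempty
    · refine ih _ (Set.ncard_lt_ncard ⟨Set.inter_subset_right, fun h => ?_⟩) d (D ∩ C) rfl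
        (hC.inter hD hST hne)
      exact hD.notMem d (h hd).1 rfl
    · have h := hC.diff hD (fun x hx hxC => hne ⟨x, hx, hxC⟩) hST
      rw [Set.sdiff_eq_empty.2 (by simpa using hd)] at h
      exact hG.not_isFragment_empty _ h
  obtain ⟨x, hx⟩ := hC.nonempty
  obtain ⟨y, hyc, hxy⟩ := exists_adj_ne hG hE hS x c
  have hy : y ∈ C := (hC.closed x hx y hxy).resolve_right hyc
  obtain ⟨z, -, hcz⟩ := exists_adj_ne hG hE hS c c
  obtain ⟨φ, hφ⟩ := hE.exists_iso hcz hxy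
  have hφC := hC.image φ
  rw [Set.image_singleton] at hφC
  rcases hφ with ⟨h, -⟩ | ⟨h, -⟩
  · exact hcut x hx _ (h ▸ hφC)
  · exact hcut y hy _ (h ▸ hφC)

theorem not_isFragment_pair [Finite V] (hG : G.Connected) (hE : IsEdgeTransitive G)
    (hS : ¬ IsStarGraph G) {u v : V} (huv : G.Adj u v) (C : Set V) :
    ¬ IsFragment G {u, v} C := by
  induction hn : C.ncard using Nat.strong_induction_on generalizing u v C with
  | _ n ih =>
  subst hn
  intro hC
  have hcut := not_isFragment_singleton hG hE hS
  -- Otherwise `v` alone would separate `C`. The edge `ux` is then a separator too, and it reaches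
  -- into `C`.
  obtain ⟨x, hx, hux⟩ : ∃ x ∈ C, G.Adj u x := by
    by_contra! h
    refine hcut v C ⟨hC.nonempty, fun x hx hxv => hC.notMem x hx (Or.inr hxv), ?_, ?_⟩
    · obtain ⟨d, hd, hd'⟩ := hC.compl_nonempty
      exact ⟨d, hd, fun h => hd' (Or.inr h)⟩
    · intro x hx y hxy
      rcases hC.closed x hx y hxy with hy | rfl | hy
      · exact Or.inl hy
      · exact (h x hx hxy.symm).elim
      · exact Or.inr hy
  obtain ⟨φ, hφ⟩ := hE.exists_iso huv hux
  have hφC := hC.image φ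
  have himg : φ '' {u, v} = {u, x} := by
    rw [Set.image_pair]
    rcases hφ with ⟨h1, h2⟩ | ⟨h1, h2⟩
    · rw [h1, h2]
    · rw [h1, h2, Set.pair_comm]
  rw [himg] at hφC
  obtain ⟨D, hD, hvD⟩ := hφC.exists_notMem v
  have huD : u ∉ D := fun h => hD.notMem u h (Or.inl rfl)
  have hST : ∀ y ∈ ({u, v} : Set V), y ∉ D := by
    rintro y (rfl | rfl)
    · exact huD
    · exact hvD
  by_cases hne : (D ∩ C).Nonempty
  · refine ih _ (Set.ncard_lt_ncard ⟨Set.inter_subset_right, fun h => ?_⟩) hux (D ∩ C) rfl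
      (hC.inter hD hST hne)
    exact hD.notMem x (h hx).1 (Or.inr rfl)
  -- Disjoint from `C`, `D` loses contact with `x`, and `u` becomes a cutvertex.
  · have h := hC.diff hD (fun x hx hxC => hne ⟨x, hx, hxC⟩) hST
    have huC : u ∉ C := fun h => hC.notMem u h (Or.inl rfl)
    have hdiff : ({u, x} : Set V) \ C = {u} := by
      ext y
      constructor
      · rintro ⟨rfl | rfl, hy⟩
        · rfl
        · exact (hy hx).elim
      · rintro rfl
        exact ⟨Or.inl rfl, huC⟩
    exact hcut u D (hdiff ▸ h)

end Connectivity

/-! ### Closing short paths. -/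

section Closing

variable {V : Type*} {G : SimpleGraph V} {u v w : V}

theorem ClosesToCycle.of_cons {h : G.Adj u v} {p : G.Walk v w}
    (hc : ClosesToCycle (Walk.cons h p)) : ClosesToCycle p := by
  obtain ⟨x, c, hc, hle⟩ := hc
  exact ⟨x, c, hc, le_trans le_sup_right hle⟩

/-- Shortcutting `q` to a path gives a return route disjoint from the interior of `p`. The length
bound excludes going back along a single edge. -/
theorem closesToCycle_of_walk {p : G.Walk u v} (hp : p.IsPath) (hlen : 1 < p.length)
    (q : G.Walk v u) (hq : ∀ x ∈ q.support, x ∈ p.support → x = u ∨ x = v) :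
    ClosesToCycle p := by
  classical
  refine ⟨u, p.append q.bypass, hp.isCycle_append q.bypass_isPath ?_ (Or.inl hlen), ?_⟩
  · intro x hxp hxq
    have hu := hp.support_nodup
    have hv := q.bypass_isPath.support_nodup
    rw [← Walk.cons_tail_support, List.nodup_cons] at hu hv
    rcases hq x (q.support_bypass_subset_support (List.mem_of_mem_tail hxq))
      (List.mem_of_mem_tail hxp) with rfl | rfl
    · exact hu.1 hxp
    · exact hv.1 hxq
  · rw [Walk.toSubgraph_append]
    exact le_sup_left

theorem closesToCycle_of_length_le_three [Finite V] (hG : G.Connected)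
    (hE : IsEdgeTransitive G) (hS : ¬ IsStarGraph G) (p : G.Walk u v) (hp : p.IsPath)
    (hlen : p.length ≤ 3) : ClosesToCycle p := by
  have two : ∀ {a b c : V} (hab : G.Adj a b) (hbc : G.Adj b c), a ≠ c →
      ClosesToCycle (Walk.cons hab (Walk.cons hbc Walk.nil)) := by
    intro a b c hab hbc hac
    obtain ⟨q, hq⟩ := exists_walk_avoiding (not_isFragment_singleton hG hE hS b)
      (a := c) (b := a) hbc.ne' hab.ne
    refine closesToCycle_of_walk (by simp [Walk.cons_isPath_iff, hab.ne, hbc.ne, hac]) (by simp)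
      q fun x hx hx' => ?_
    have := hq x hx
    simp at hx' this
    tauto
  have one : ∀ {a b : V} (hab : G.Adj a b), ClosesToCycle (Walk.cons hab Walk.nil) := by
    intro a b hab
    obtain ⟨c, hcb, hac⟩ := exists_adj_ne hG hE hS a b
    exact (two hac.symm hab hcb).of_cons
  match p, hp, hlen with
  | .nil, _, _ =>
    obtain ⟨c, -, hc⟩ := exists_adj_ne hG hE hS u u
    exact (one hc.symm).of_cons
  | .cons h .nil, _, _ => exact one h
  | .cons h (.cons h' .nil), hp, _ =>
    refine two h h' ?_
    rintro rfl
    simp at hp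
  | .cons (v := b) h (.cons (v := c) h' (.cons h'' .nil)), hp, _ =>
    have hp' := hp
    simp only [Walk.cons_isPath_iff, Walk.support_cons, Walk.support_nil, List.mem_cons,
      List.not_mem_nil, or_false, not_or] at hp'
    obtain ⟨q, hq⟩ := exists_walk_avoiding (not_isFragment_pair hG hE hS h')
      (a := v) (b := u) (by simp; tauto) (by simp; tauto)
    refine closesToCycle_of_walk hp (by simp) q fun x hx hx' => ?_
    have := hq x hx
    simp at hx' this
    tauto
  | .cons _ (.cons _ (.cons _ (.cons _ p))), _, hlen => simp only [Walk.length_cons] at hlen; omega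

end Closing

/-! ### The graphs `K_n^◇`. -/

section Diamond

variable {n : ℕ}

/-- The vertex `v_{ij}`. -/
abbrev diamondMid (i j : Fin n) (h : i ≠ j) : DiamondVertex n := Sum.inr ⟨(i, j), h⟩

theorem diamondGraph_adj_inr_inl (a : Fin n) (q : {q : Fin n × Fin n // q.1 ≠ q.2}) :
    (diamondGraph n).Adj (Sum.inr q) (Sum.inl a) ↔ a = q.1.1 ∨ a = q.1.2 := Iff.rfl

theorem card_diamondVertex (n : ℕ) : Nat.card (DiamondVertex n) = n * n := by
  have h : Nat.card {q : Fin n × Fin n // q.1 ≠ q.2} + n = n * n := by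
    have h1 : Nat.card {q : Fin n × Fin n // q.1 = q.2} = n := by
      rw [Nat.card_congr (β := Fin n) ⟨fun q => q.1.1, fun i => ⟨(i, i), rfl⟩, ?_, fun _ => rfl⟩,
        Nat.card_fin]
      rintro ⟨⟨i, j⟩, rfl : i = j⟩
      rfl
    have h2 := Nat.card_congr (Equiv.sumCompl fun q : Fin n × Fin n => q.1 = q.2)
    rw [Nat.card_sum, Nat.card_prod, Nat.card_fin, h1] at h2
    rw [add_comm]
    exact h2
  rw [Nat.card_sum, Nat.card_fin, add_comm, h]

theorem isEmpty_diamondGraph_iso {m n : ℕ} (h : m ≠ n) :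
    IsEmpty (diamondGraph m ≃g diamondGraph n) := by
  refine ⟨fun φ => h ?_⟩
  have := Nat.card_congr φ.toEquiv
  rw [card_diamondVertex, card_diamondVertex] at this
  exact Nat.mul_self_inj.1 this

theorem diamondGraph_connected (hn : n ≠ 0) : (diamondGraph n).Connected := by
  have : NeZero n := ⟨hn⟩
  have h0 : ∀ a : Fin n, (diamondGraph n).Reachable (Sum.inl a) (Sum.inl 0) := by
    intro a
    by_cases ha : a = 0
    · rw [ha]
    · have h1 : (diamondGraph n).Adj (Sum.inl a) (diamondMid a 0 ha) := Or.inl rfl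
      have h2 : (diamondGraph n).Adj (diamondMid a 0 ha) (Sum.inl 0) := Or.inr rfl
      exact h1.reachable.trans h2.reachable
  have hall : ∀ x, (diamondGraph n).Reachable x (Sum.inl 0) := by
    rintro (a | q)
    · exact h0 a
    · have h1 : (diamondGraph n).Adj (Sum.inr q) (Sum.inl q.1.1) := Or.inl rfl
      exact h1.reachable.trans (h0 _)
  exact (connected_iff _).2 ⟨fun x y => (hall x).trans (hall y).symm, ⟨Sum.inl 0⟩⟩

/-- The automorphism of `K_n^◇` induced by a permutation of the vertices of `K_n`. -/
def diamondPerm (σ : Equiv.Perm (Fin n)) : diamondGraph n ≃g diamondGraph n where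
  toEquiv := Equiv.sumCongr σ ((Equiv.prodCongr σ σ).subtypeEquiv fun q => by simp)
  map_rel_iff' := by
    rintro (a | q) (b | r)
    · rfl
    · exact or_congr σ.injective.eq_iff σ.injective.eq_iff
    · exact or_congr σ.injective.eq_iff σ.injective.eq_iff
    · rfl

/-- The automorphism of `K_n^◇` exchanging `v_{ij}` and `v_{ji}` for all `i`, `j`. -/
def diamondSwap (n : ℕ) : diamondGraph n ≃g diamondGraph n where
  toEquiv := Equiv.sumCongr (Equiv.refl _)
    ((Equiv.prodComm _ _).subtypeEquiv fun q => by simp [eq_comm])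
  map_rel_iff' := by
    rintro (a | q) (b | r)
    · rfl
    · exact or_comm
    · exact or_comm
    · rfl

theorem exists_diamondPerm {i j k l : Fin n} (hij : i ≠ j) (hkl : k ≠ l) :
    ∃ σ : Equiv.Perm (Fin n), σ i = k ∧ σ j = l := by
  refine ⟨Equiv.swap (Equiv.swap i k j) l * Equiv.swap i k, ?_, by simp⟩
  rw [Equiv.Perm.mul_apply, Equiv.swap_apply_left]
  exact Equiv.swap_apply_of_ne_of_ne
    (fun h => hij ((Equiv.swap i k).injective ((Equiv.swap_apply_left i k).trans h))) hkl

theorem isEdgeTransitive_diamondGraph (n : ℕ) : IsEdgeTransitive (diamondGraph n) := by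
  -- every edge can be mapped to any edge of the form `v_k v_{kl}`
  have key : ∀ e ∈ (diamondGraph n).edgeSet, ∃ i j, ∃ h : i ≠ j, ∃ φ : diamondGraph n ≃g
      diamondGraph n, Sym2.map φ s(Sum.inl i, diamondMid i j h) = e := by
    have aux : ∀ a q, (diamondGraph n).Adj (Sum.inl a) (Sum.inr q) → ∃ i j, ∃ h : i ≠ j,
        ∃ φ : diamondGraph n ≃g diamondGraph n,
          Sym2.map φ s(Sum.inl i, diamondMid i j h) = s(Sum.inl a, Sum.inr q) := by
      rintro a ⟨⟨i, j⟩, hij⟩ (rfl | rfl)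
      · exact ⟨_, _, hij, RelIso.refl _, rfl⟩
      · exact ⟨_, _, hij.symm, diamondSwap n, rfl⟩
    intro e
    induction e with
    | _ x y =>
    intro hxy
    rcases x with a | q <;> rcases y with b | r
    · exact hxy.elim
    · exact aux _ _ hxy
    · rw [Sym2.eq_swap]
      exact aux _ _ hxy
    · exact hxy.elim
  intro e he f hf
  obtain ⟨i, j, hij, φ, rfl⟩ := key e he
  obtain ⟨k, l, hkl, ψ, rfl⟩ := key f hf
  obtain ⟨σ, rfl, rfl⟩ := exists_diamondPerm hij hkl
  refine ⟨(φ.symm.trans (diamondPerm σ)).trans ψ, ?_⟩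
  have h : ∀ x, ((φ.symm.trans (diamondPerm σ)).trans ψ) (φ x) = ψ (diamondPerm σ x) :=
    fun x => congrArg (fun y => ψ (diamondPerm σ y)) (φ.symm_apply_apply x)
  rw [Sym2.map_mk, Sym2.map_mk, h, h]
  rfl

/-- A path through `v_{ij}` and through edges `v_i v_{ji}` and `v_i v_{ik}` closes to no cycle. -/
theorem not_closesToCycle_of_adj {x y : DiamondVertex n} {p : (diamondGraph n).Walk x y}
    {i j k : Fin n} (hij : i ≠ j) (hik : i ≠ k) (hjk : j ≠ k)
    (h₁ : diamondMid i j hij ∈ p.support)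
    (h₂ : p.toSubgraph.Adj (Sum.inl i) (diamondMid j i hij.symm))
    (h₃ : p.toSubgraph.Adj (Sum.inl i) (diamondMid i k hik)) : ¬ ClosesToCycle p := by
  rintro ⟨w, c, hc, hle⟩
  have hmem : ∀ z, z ∈ p.toSubgraph.verts → (c.toSubgraph.neighborSet z).ncard = 2 :=
    fun z hz => hc.ncard_neighborSet_toSubgraph_eq_two (c.mem_verts_toSubgraph.1 (hle.1 hz))
  -- The cycle must use both edges at `v_{ij}`; this gives `v_i` a third neighbour on it.
  have hadj : c.toSubgraph.Adj (diamondMid i j hij) (Sum.inl i) := by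
    have hsub : c.toSubgraph.neighborSet (diamondMid i j hij) ⊆ {Sum.inl i, Sum.inl j} := by
      rintro (a | q) hz
      · have := (diamondGraph_adj_inr_inl _ _).1 (c.toSubgraph.adj_sub hz)
        simpa using this
      · exact (c.toSubgraph.adj_sub hz).elim
    have heq := Set.eq_of_subset_of_ncard_le hsub (by
      rw [hmem _ (p.mem_verts_toSubgraph.2 h₁)]
      exact (Set.ncard_insert_le _ _).trans (by rw [Set.ncard_singleton]))
    have : Sum.inl i ∈ c.toSubgraph.neighborSet (diamondMid i j hij) := by rw [heq]; simp
    exact this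
  have hcard := hmem (Sum.inl i) (p.toSubgraph.edge_vert h₂)
  have hsub : {diamondMid i j hij, diamondMid j i hij.symm, diamondMid i k hik} ⊆
      c.toSubgraph.neighborSet (Sum.inl i) := by
    rintro z (rfl | rfl | rfl)
    · exact hadj.symm
    · exact hle.2 h₂
    · exact hle.2 h₃
  have h3 := Set.ncard_le_ncard hsub (Set.toFinite _)
  rw [hcard, Set.ncard_eq_three.2 ⟨_, _, _, ?_, ?_, ?_, rfl⟩] at h3
  · omega
  · simp [diamondMid, hij]
  · simp [diamondMid, hjk]
  · simp [diamondMid, hij.symm]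

/-- All indices of a vertex of `K_n^◇` are less than `b`. -/
def DiamondVertex.IndexLT (b : ℕ) : DiamondVertex n → Prop
  | .inl a => (a : ℕ) < b
  | .inr q => (q.1.1 : ℕ) < b ∧ (q.1.2 : ℕ) < b

/-- The path `v_{01}, v_1, v_{10}, v_0, v_{02}` extends to long paths. -/
theorem exists_path_diamondGraph (h0 : 0 < n) (h1 : 1 < n) (h2 : 2 < n) (k : ℕ)
    (hk : k + 2 < n) : ∃ (a : Fin n) (hab : a ≠ ⟨k + 2, hk⟩)
      (p : (diamondGraph n).Walk (diamondMid a ⟨k + 2, hk⟩ hab)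
        (diamondMid ⟨0, h0⟩ ⟨1, h1⟩ (by simp))),
      p.IsPath ∧ p.length = 4 + 2 * k ∧ (∀ x ∈ p.support, x.IndexLT (k + 3)) ∧
      Sum.inl ⟨k + 2, hk⟩ ∉ p.support ∧
      p.toSubgraph.Adj (Sum.inl ⟨0, h0⟩) (diamondMid ⟨1, h1⟩ ⟨0, h0⟩ (by simp)) ∧
      p.toSubgraph.Adj (Sum.inl ⟨0, h0⟩) (diamondMid ⟨0, h0⟩ ⟨2, h2⟩ (by simp)) := by
  induction k with
  | zero =>
    have e1 : (diamondGraph n).Adj (diamondMid ⟨0, h0⟩ ⟨2, h2⟩ (by simp)) (Sum.inl ⟨0, h0⟩) :=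
      Or.inl rfl
    have e2 : (diamondGraph n).Adj (Sum.inl ⟨0, h0⟩) (diamondMid ⟨1, h1⟩ ⟨0, h0⟩ (by simp)) :=
      Or.inr rfl
    have e3 : (diamondGraph n).Adj (diamondMid ⟨1, h1⟩ ⟨0, h0⟩ (by simp)) (Sum.inl ⟨1, h1⟩) :=
      Or.inl rfl
    have e4 : (diamondGraph n).Adj (Sum.inl ⟨1, h1⟩) (diamondMid ⟨0, h0⟩ ⟨1, h1⟩ (by simp)) :=
      Or.inr rfl
    refine ⟨⟨0, h0⟩, by simp, .cons e1 (.cons e2 (.cons e3 (.cons e4 .nil))), ?_, rfl, ?_, ?_,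
      ?_, ?_⟩
    · simp [Walk.cons_isPath_iff]
    · simp [DiamondVertex.IndexLT]
    · simp
    · simp
    · simp
  | succ k ih =>
    -- Prepend `v_{k+2,k+3}, v_{k+2}`: the first is new by the index bound, the second by `hnot`.
    obtain ⟨a, hab, p, hp, hlen, hlt, hnot, hadj₁, hadj₂⟩ := ih (by omega)
    have hne : (⟨k + 2, by omega⟩ : Fin n) ≠ ⟨k + 1 + 2, hk⟩ := by simp
    have e1 : (diamondGraph n).Adj (Sum.inl ⟨k + 2, by omega⟩) (diamondMid a ⟨k + 2, _⟩ hab) :=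
      Or.inr rfl
    have e2 : (diamondGraph n).Adj (diamondMid ⟨k + 2, by omega⟩ ⟨k + 1 + 2, hk⟩ hne)
      (Sum.inl ⟨k + 2, by omega⟩) := Or.inl rfl
    have hmid : diamondMid ⟨k + 2, by omega⟩ ⟨k + 1 + 2, hk⟩ hne ∉ p.support := by
      intro h
      have : k + 2 < k + 3 ∧ k + 1 + 2 < k + 3 := hlt _ h
      omega
    have hinl : Sum.inl ⟨k + 1 + 2, hk⟩ ∉ p.support := by
      intro h
      have : k + 1 + 2 < k + 3 := hlt _ h
      omega
    refine ⟨⟨k + 2, by omega⟩, hne, .cons e2 (.cons e1 p), ?_, ?_, ?_, ?_, ?_, ?_⟩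
    · simp [Walk.cons_isPath_iff, hp, hnot, hmid]
    · simp [hlen]; omega
    · have hmono : ∀ x ∈ p.support, x.IndexLT (k + 1 + 3) := by
        rintro (x | x) hx
        · exact (hlt _ hx).trans (by omega)
        · exact ⟨(hlt _ hx).1.trans (by omega), (hlt _ hx).2.trans (by omega)⟩
      intro x hx
      rw [Walk.support_cons, Walk.support_cons, List.mem_cons, List.mem_cons] at hx
      rcases hx with rfl | rfl | hx
      · exact ⟨show k + 2 < k + 1 + 3 by omega, show k + 1 + 2 < k + 1 + 3 by omega⟩
      · exact show k + 2 < k + 1 + 3 by omega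
      · exact hmono x hx
    · simp [hinl]
    · exact Or.inr (Or.inr hadj₁)
    · exact Or.inr (Or.inr hadj₂)

theorem exists_path_not_closesToCycle {ℓ : ℕ} (hℓ : 4 ≤ ℓ) (hn : ℓ ≤ n) :
    ∃ (u v : DiamondVertex n) (p : (diamondGraph n).Walk u v),
      p.IsPath ∧ p.length = ℓ ∧ ¬ ClosesToCycle p := by
  -- For odd `ℓ`, the unused vertex `v_{k+2}` supplies one more edge at the start.
  obtain ⟨k, hk⟩ : ∃ k, ℓ = 4 + 2 * k ∨ ℓ = 4 + 2 * k + 1 := ⟨(ℓ - 4) / 2, by omega⟩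
  obtain ⟨a, hab, p, hp, hlen, -, hnot, hadj₁, hadj₂⟩ :=
    exists_path_diamondGraph (n := n) (by omega) (by omega) (by omega) k (by omega)
  have hopen : ¬ ClosesToCycle p :=
    not_closesToCycle_of_adj _ _ (by simp) p.end_mem_support hadj₁ hadj₂
  rcases hk with hk | hk
  · exact ⟨_, _, p, hp, by omega, hopen⟩
  · have e : (diamondGraph n).Adj (Sum.inl ⟨k + 2, by omega⟩) (diamondMid a ⟨k + 2, _⟩ hab) :=
      Or.inr rfl
    exact ⟨_, _, .cons e p, hp.cons hnot, by rw [Walk.length_cons]; omega,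
      fun h => hopen h.of_cons⟩

end Diamond

theorem mainTheorem3 :
    -- Every path of length at most 3 closes to a cycle.
    (∀ (V : Type*) [Finite V] (G : SimpleGraph V),
      G.Connected → IsEdgeTransitive G → ¬ IsStarGraph G →
        ∀ (u v : V) (p : G.Walk u v), p.IsPath → p.length ≤ 3 → ClosesToCycle p) ∧
    -- For every `ℓ ≥ 4`, all but finitely many of the graphs `K_n^◇` are counterexamples,
    (∀ ℓ : ℕ, 4 ≤ ℓ → ∃ N : ℕ, 3 ≤ N ∧ ∀ n : ℕ, N ≤ n →
      (diamondGraph n).Connected ∧ IsEdgeTransitive (diamondGraph n) ∧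
        ∃ (u v : DiamondVertex n) (p : (diamondGraph n).Walk u v),
          p.IsPath ∧ p.length = ℓ ∧ ¬ ClosesToCycle p) ∧
    -- and these graphs are pairwise non-isomorphic.
    (∀ m n : ℕ, m ≠ n → IsEmpty (diamondGraph m ≃g diamondGraph n)) :=
  ⟨fun _ _ _ hG hE hS _ _ p => closesToCycle_of_length_le_three hG hE hS p,
    fun ℓ hℓ => ⟨ℓ, by omega, fun n hn => ⟨diamondGraph_connected (by omega),
      isEdgeTransitive_diamondGraph n, exists_path_not_closesToCycle hℓ hn⟩⟩,
    fun _ _ => isEmpty_diamondGraph_iso⟩
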